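/- Let $G$ be a finite metacyclic group, i.e. a finite group with a cyclic normal subgroup $K$ such that $G/K$ is cyclic; write $G'$ for the commutator subgroup of $G$ and $x^g=g^{-1}xg$. Let $\mathcal F$ be a family of distinct subgroups of $G$ that is closed under conjugation ($F^g=g^{-1}Fg\in\mathcal F$ for all $F\in\mathcal F$, $g\in G$) and is - generating: $\bigl\langle\bigcup_{F\in\mathcal F}F\bigr\rangle=G$; - regular: $[F,N_G(F)]=F\cap G'$ for every $F\in\mathcal F$, where $N_G(F)$ is the normalizer of $F$ in $G$; - independent: for a complete set $\mathcal T\subseteq\mathcal F$ of representatives of the conjugacy classes of members of $\mathcal F$, the canonical homomorphism $\bigoplus_{F\in\mathcal T}F/(F\cap G')\to G/G'$ is an isomorphism (this does not depend on the choice of $\mathcal T$). Let $S$ be the active sum of $\mathcal F$, that is, the quotient of the free product of the members of $\mathcal F$ by the normal subgroup generated by all elements $h^{-1}\cdot g\cdot h\cdot(g^h)^{-1}$ with $h\in F_1$, $g\in F_2$, $F_1,F_2\in\mathcal F$, where $g^h$ is taken in the member $F_2^h$ of $\mathcal F$. Then the canonical homomorphism $\varphi\colon S\to G$, which restricts to the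 inclusion on each $F\in\mathcal F$, is an isomorphism. In particular $S\cong G$. -/

import Mathlib

/-- A group is metacyclic if it has a cyclic normal subgroup with cyclic quotient. -/
def IsMetacyclic (G : Type*) [Group G] : Prop :=
  ∃ (K : Subgroup G) (_ : K.Normal), IsCyclic K ∧ IsCyclic (G ⧸ K)

namespace SubgroupFamily

/-- The conjugate subgroup `F ^ g = g⁻¹ F g`. -/
def conjBy {G : Type*} [Group G] (F : Subgroup G) (g : G) : Subgroup G :=
  F.map (MulAut.conj g⁻¹).toMonoidHom

theorem mem_conjBy {G : Type*} [Group G] (F : Subgroup G) (g x : G) :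
    x ∈ conjBy F g ↔ ∃ y ∈ F, g⁻¹ * y * g = x := by
  simp [conjBy, Subgroup.mem_map]

/-- A family of (distinct) subgroups of `G`, given as a set, is generating if its members
together generate `G`. -/
def IsGenerating {G : Type*} [Group G] (𝓕 : Set (Subgroup G)) : Prop :=
  Subgroup.closure (⋃ F ∈ 𝓕, (F : Set G)) = ⊤

/-- The family is closed under conjugation. -/
def IsConjClosed {G : Type*} [Group G] (𝓕 : Set (Subgroup G)) : Prop :=
  ∀ F ∈ 𝓕, ∀ g : G, conjBy F g ∈ 𝓕

/-- The free product of the members of the family. -/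
abbrev FreeProduct {G : Type*} [Group G] (𝓕 : Set (Subgroup G)) : Type _ :=
  Monoid.CoprodI (fun F : 𝓕 => (F : Subgroup G))

/-- The inclusion of a member of the family in the free product. -/
def incl {G : Type*} [Group G] (𝓕 : Set (Subgroup G)) (F : 𝓕) :
    (F : Subgroup G) →* FreeProduct 𝓕 :=
  Monoid.CoprodI.of (M := fun F : 𝓕 => (F : Subgroup G)) (i := F)

/-- The elements `h⁻¹ · g · h · (g ^ h)⁻¹` of the free product, with `h ∈ F₁`, `g ∈ F₂`, where
`k = g ^ h = h⁻¹ g h` is taken in the member `F₃ = F₂ ^ h` of the family. -/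
def relators {G : Type*} [Group G] (𝓕 : Set (Subgroup G)) : Set (FreeProduct 𝓕) :=
  {x | ∃ (F₁ F₂ F₃ : 𝓕) (h : (F₁ : Subgroup G)) (g : (F₂ : Subgroup G)) (k : (F₃ : Subgroup G)),
    (F₃ : Subgroup G) = conjBy (F₂ : Subgroup G) (h : G) ∧
    (k : G) = (h : G)⁻¹ * (g : G) * (h : G) ∧
    x = (incl 𝓕 F₁ h)⁻¹ * incl 𝓕 F₂ g * incl 𝓕 F₁ h * (incl 𝓕 F₃ k)⁻¹}

/-- The active sum of the family (intended for families closed under conjugation). -/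
abbrev ActiveSum {G : Type*} [Group G] (𝓕 : Set (Subgroup G)) : Type _ :=
  FreeProduct 𝓕 ⧸ Subgroup.normalClosure (relators 𝓕)

/-- The homomorphism from the free product to `G` which is the inclusion on each member. -/
def freeProductToGroup {G : Type*} [Group G] (𝓕 : Set (Subgroup G)) : FreeProduct 𝓕 →* G :=
  Monoid.CoprodI.lift (fun F : 𝓕 => (F : Subgroup G).subtype)

theorem freeProductToGroup_incl {G : Type*} [Group G] (𝓕 : Set (Subgroup G)) (F : 𝓕)
    (x : (F : Subgroup G)) : freeProductToGroup 𝓕 (incl 𝓕 F x) = x := by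
  simp [freeProductToGroup, incl]

theorem normalClosure_relators_le_ker {G : Type*} [Group G] (𝓕 : Set (Subgroup G)) :
    Subgroup.normalClosure (relators 𝓕) ≤ (freeProductToGroup 𝓕).ker := by
  apply Subgroup.normalClosure_le_normal
  rintro _ ⟨F₁, F₂, F₃, h, g, k, -, hk, rfl⟩
  simp [MonoidHom.mem_ker, freeProductToGroup_incl, hk, mul_assoc]

/-- The canonical homomorphism from the active sum to `G`. -/
def activeSumToGroup {G : Type*} [Group G] (𝓕 : Set (Subgroup G)) : ActiveSum 𝓕 →* G :=
  QuotientGroup.lift (Subgroup.normalClosure (relators 𝓕)) (freeProductToGroup 𝓕)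
    (normalClosure_relators_le_ker 𝓕)

/-- The family is regular: `[F, N_G(F)] = F ∩ G'` for each member `F`. -/
def IsRegular {G : Type*} [Group G] (𝓕 : Set (Subgroup G)) : Prop :=
  ∀ F ∈ 𝓕, ⁅F, Subgroup.normalizer (F : Set G)⁆ = F ⊓ commutator G

/-- A transversal of the family: a complete set of representatives of the conjugacy classes
of its members. -/
def IsTransversal {G : Type*} [Group G] (𝓕 𝓣 : Set (Subgroup G)) : Prop :=
  𝓣 ⊆ 𝓕 ∧ ∀ F ∈ 𝓕, ∃! T : Subgroup G, T ∈ 𝓣 ∧ ∃ g : G, T = conjBy F g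

/-- The quotient `F / (F ∩ G')`. -/
abbrev QuotDerived {G : Type*} [Group G] (F : Subgroup G) : Type _ :=
  F ⧸ (commutator G).subgroupOf F

/-- The canonical homomorphism `F / (F ∩ G') → G / G'`. -/
def quotDerivedMap {G : Type*} [Group G] (F : Subgroup G) :
    QuotDerived F →* Abelianization G :=
  QuotientGroup.map ((commutator G).subgroupOf F) (commutator G) F.subtype le_rfl

theorem quotDerivedMap_injective {G : Type*} [Group G] (F : Subgroup G) :
    Function.Injective (quotDerivedMap F) := by
  rw [injective_iff_map_eq_one]
  intro x
  induction x using QuotientGroup.induction_on with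
  | H y =>
    intro h
    have h' : ((y : G) : G ⧸ commutator G) = 1 := h
    rw [QuotientGroup.eq_one_iff] at h' ⊢
    exact h'

instance quotDerivedCommGroup {G : Type*} [Group G] (F : Subgroup G) :
    CommGroup (QuotDerived F) :=
  { (inferInstance : Group (QuotDerived F)) with
    mul_comm := fun x y => quotDerivedMap_injective F (by
      rw [map_mul, map_mul, mul_comm]) }

open Classical in
/-- The canonical homomorphism `⨁_{F ∈ 𝓣} F / (F ∩ G') → G / G'`, written additively. -/
noncomputable def directSumMap {G : Type*} [Group G] (𝓣 : Set (Subgroup G)) :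
    DirectSum 𝓣 (fun F => Additive (QuotDerived (F : Subgroup G))) →+
      Additive (Abelianization G) :=
  DirectSum.toAddMonoid (fun F : 𝓣 => MonoidHom.toAdditive (quotDerivedMap (F : Subgroup G)))

/-- The family is independent: for a transversal `𝓣` of it, the canonical homomorphism
`⨁_{F ∈ 𝓣} F / (F ∩ G') → G / G'` is an isomorphism. (The image of `F / (F ∩ G')` in `G / G'`
depends only on the conjugacy class of `F`, so the choice of `𝓣` does not matter.) -/
def IsIndependent {G : Type*} [Group G] (𝓕 : Set (Subgroup G)) : Prop :=
  ∃ 𝓣 : Set (Subgroup G), IsTransversal 𝓕 𝓣 ∧ Function.Bijective (directSumMap 𝓣)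

end SubgroupFamily

/-! Write φ for the canonical map S → G. In S, conjugation by s carries the copy of F to that of its
conjugate by φ(s) (`conj_toActiveSum`), so whatever lies over the centre of G is central in S; in
particular ker φ is central. Regularity and independence make S^ab → G^ab injective, hence ker φ ≤
S'. Let K be cyclic normal in G with G/K cyclic. Its preimage N in S is cyclic modulo the central
ker φ, hence abelian, and S = N⟨b⟩, so every element of S' is a single commutator [t, b] with t ∈ N.
If it lies in ker φ, then φ(t) commutes with φ(b) and with K, so φ(t) is central in G; hence t is
central in S and [t, b] = 1. -/

namespace SubgroupFamily

variable {G : Type*} [Group G] {𝓕 : Set (Subgroup G)}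

/-- The canonical homomorphism from a member of the family to the active sum. -/
def toActiveSum (F : 𝓕) : (F : Subgroup G) →* ActiveSum 𝓕 :=
  (QuotientGroup.mk' (Subgroup.normalClosure (relators 𝓕))).comp (incl 𝓕 F)

theorem activeSumToGroup_toActiveSum (F : 𝓕) (x : (F : Subgroup G)) :
    activeSumToGroup 𝓕 (toActiveSum F x) = x :=
  freeProductToGroup_incl 𝓕 F x

theorem activeSum_induction {p : ActiveSum 𝓕 → Prop} (s : ActiveSum 𝓕) (one : p 1)
    (of : ∀ (F : 𝓕) (x : (F : Subgroup G)), p (toActiveSum F x))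
    (mul : ∀ s t, p s → p t → p (s * t)) : p s := by
  induction s using QuotientGroup.induction_on with
  | H w =>
    induction w using Monoid.CoprodI.induction_on with
    | one => exact one
    | of F x => exact of F x
    | mul x y hx hy => exact mul _ _ hx hy

theorem activeSumToGroup_surjective (hgen : IsGenerating 𝓕) :
    Function.Surjective (activeSumToGroup 𝓕) := by
  rw [← MonoidHom.range_eq_top, eq_top_iff, ← hgen, Subgroup.closure_le]
  intro x hx
  simp only [Set.mem_iUnion] at hx
  obtain ⟨F, hF, hx⟩ := hx
  exact ⟨toActiveSum ⟨F, hF⟩ ⟨x, hx⟩, activeSumToGroup_toActiveSum ⟨F, hF⟩ ⟨x, hx⟩⟩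

theorem toActiveSum_conj_toActiveSum (F₁ F₂ F₃ : 𝓕) (h : (F₁ : Subgroup G))
    (g : (F₂ : Subgroup G)) (k : (F₃ : Subgroup G))
    (hF : (F₃ : Subgroup G) = conjBy (F₂ : Subgroup G) (h : G))
    (hk : (k : G) = (h : G)⁻¹ * (g : G) * (h : G)) :
    (toActiveSum F₁ h)⁻¹ * toActiveSum F₂ g * toActiveSum F₁ h = toActiveSum F₃ k := by
  rw [← mul_inv_eq_one]
  exact (QuotientGroup.eq_one_iff _).2
    (Subgroup.subset_normalClosure ⟨F₁, F₂, F₃, h, g, k, hF, hk, rfl⟩)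

theorem conjBy_one (F : Subgroup G) : conjBy F 1 = F := by
  ext x
  simp [mem_conjBy]

theorem conjBy_mul (F : Subgroup G) (g h : G) : conjBy F (g * h) = conjBy (conjBy F g) h := by
  ext x
  simp [mem_conjBy, mul_assoc]

/-- The active sum acts on the images of the members of the family through `G`. -/
theorem conj_toActiveSum (hconj : IsConjClosed 𝓕) (s : ActiveSum 𝓕) :
    ∀ (F F' : 𝓕) (g : (F : Subgroup G)) (k : (F' : Subgroup G)),
      (F' : Subgroup G) = conjBy (F : Subgroup G) (activeSumToGroup 𝓕 s) →
      (k : G) = (activeSumToGroup 𝓕 s)⁻¹ * (g : G) * activeSumToGroup 𝓕 s →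
      s⁻¹ * toActiveSum F g * s = toActiveSum F' k := by
  induction s using activeSum_induction with
  | one =>
    rintro ⟨F, hF⟩ ⟨F', hF'⟩ ⟨g, hg⟩ ⟨k, hk⟩ h h'
    simp only [map_one, conjBy_one, inv_one, one_mul, mul_one] at h h' ⊢
    subst h h'
    rfl
  | of F₁ x =>
    intro F F' g k h h'
    rw [activeSumToGroup_toActiveSum] at h h'
    exact toActiveSum_conj_toActiveSum F₁ F F' x g k h h'
  | mul s t hs ht =>
    intro F F' g k h h'
    rw [map_mul] at h h'
    rw [conjBy_mul] at h
    have key := hs F ⟨_, hconj F F.2 (activeSumToGroup 𝓕 s)⟩ g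
      ⟨_, (mem_conjBy _ _ _).2 ⟨g, g.2, rfl⟩⟩ rfl rfl
    rw [← ht ⟨_, hconj F F.2 (activeSumToGroup 𝓕 s)⟩ F'
      ⟨_, (mem_conjBy _ _ _).2 ⟨g, g.2, rfl⟩⟩ k h (by rw [h']; group), ← key]
    group

theorem conjBy_eq_self_of_mem_normalizer {F : Subgroup G} {g : G}
    (hg : g ∈ Subgroup.normalizer (F : Set G)) : conjBy F g = F := by
  ext x
  rw [mem_conjBy]
  constructor
  · rintro ⟨y, hy, rfl⟩
    have := (Subgroup.mem_normalizer_iff.1 (inv_mem hg) y).1 hy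
    simpa using this
  · intro hx
    exact ⟨g * x * g⁻¹, (Subgroup.mem_normalizer_iff.1 hg x).1 hx, by group⟩

/-- An element of the active sum lying over the centre of `G` is central. -/
theorem commute_of_activeSumToGroup_mem_center (hconj : IsConjClosed 𝓕) {t : ActiveSum 𝓕}
    (ht : activeSumToGroup 𝓕 t ∈ Subgroup.center G) (s : ActiveSum 𝓕) : Commute s t := by
  induction s using activeSum_induction with
  | one => exact Commute.one_left t
  | of F x =>
    have hx : t⁻¹ * toActiveSum F x * t = toActiveSum F x :=
      conj_toActiveSum hconj t F F x x
        (conjBy_eq_self_of_mem_normalizer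
          (Subgroup.center_le_normalizer _ ht)).symm
        (by rw [mul_assoc, Subgroup.mem_center_iff.1 ht, inv_mul_cancel_left])
    rw [mul_assoc, inv_mul_eq_iff_eq_mul] at hx
    exact hx
  | mul x y hx hy => exact hx.mul_left hy

/-- By regularity x is a product of commutators [f, n]^±1 with f ∈ F and n normalizing F. Lifting n
to s in the active sum, conjugation by s acts on the copy of F as n does, so [f, n] maps to the
commutator of the image of f with s. -/
theorem abelianization_of_toActiveSum_eq_one (hconj : IsConjClosed 𝓕) (hgen : IsGenerating 𝓕)
    (hreg : IsRegular 𝓕) (F : 𝓕) (x : (F : Subgroup G)) (hx : (x : G) ∈ commutator G) :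
    Abelianization.of (toActiveSum F x) = 1 := by
  have hle : ⁅(F : Subgroup G), Subgroup.normalizer ((F : Subgroup G) : Set G)⁆ ≤
      (Abelianization.of.comp (toActiveSum F)).ker.map (F : Subgroup G).subtype := by
    rw [Subgroup.commutator_le]
    intro f hf n hn
    obtain ⟨s, rfl⟩ := activeSumToGroup_surjective hgen n
    have hmem := (Subgroup.mem_normalizer_iff.1 hn f⁻¹).1 (inv_mem hf)
    have h := conj_toActiveSum hconj s⁻¹ F F ⟨f⁻¹, inv_mem hf⟩ ⟨_, hmem⟩
      (by rw [map_inv, conjBy_eq_self_of_mem_normalizer (inv_mem hn)]) (by simp)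
    refine ⟨⟨f, hf⟩ * ⟨_, hmem⟩, ?_, by simp [commutatorElement_def, mul_assoc]⟩
    have hinv : toActiveSum F ⟨f⁻¹, inv_mem hf⟩ = (toActiveSum F ⟨f, hf⟩)⁻¹ :=
      map_inv (toActiveSum F) ⟨f, hf⟩
    change Abelianization.of (toActiveSum F (⟨f, hf⟩ * ⟨_, hmem⟩)) = 1
    rw [map_mul, ← h, hinv]
    simp only [map_mul, map_inv]
    rw [mul_right_comm _ _ (Abelianization.of s)⁻¹]
    simp
  obtain ⟨y, hy, hyx⟩ := hle ((hreg F F.2).ge ⟨x.2, hx⟩)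
  rw [← Subtype.ext hyx]
  exact hy

open Classical in
/-- The kernel of the canonical homomorphism to `G` lies in the derived subgroup of the active
sum, for regular independent families. -/
theorem ker_activeSumToGroup_le_commutator (hconj : IsConjClosed 𝓕) (hgen : IsGenerating 𝓕)
    (hreg : IsRegular 𝓕) (hind : IsIndependent 𝓕) :
    (activeSumToGroup 𝓕).ker ≤ commutator (ActiveSum 𝓕) := by
  obtain ⟨𝓣, ⟨hsub, hrep⟩, hinj, -⟩ := hind
  let q (F : 𝓣) : QuotDerived (F : Subgroup G) →* Abelianization (ActiveSum 𝓕) :=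
    QuotientGroup.lift _ (Abelianization.of.comp (toActiveSum ⟨F, hsub F.2⟩)) fun x hx =>
      MonoidHom.mem_ker.2
        (abelianization_of_toActiveSum_eq_one hconj hgen hreg ⟨F, hsub F.2⟩ x hx)
  let τ : DirectSum 𝓣 (fun F => Additive (QuotDerived (F : Subgroup G))) →+
      Additive (Abelianization (ActiveSum 𝓕)) :=
    DirectSum.toAddMonoid (fun F : 𝓣 => MonoidHom.toAdditive (q F))
  -- τ is surjective: each member is conjugate to one in 𝓣, and conjugation in the active sum is
  -- invisible in its abelianization.
  have hτ : ∀ s : ActiveSum 𝓕, ∃ w, τ w = Additive.ofMul (Abelianization.of s) := by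
    intro s
    induction s using activeSum_induction with
    | one => exact ⟨0, by simp⟩
    | of F x =>
      obtain ⟨T, ⟨hT, g, rfl⟩, -⟩ := hrep F F.2
      obtain ⟨s, rfl⟩ := activeSumToGroup_surjective hgen g
      have h := conj_toActiveSum hconj s F ⟨_, hsub hT⟩ x
        ⟨_, (mem_conjBy _ _ _).2 ⟨x, x.2, rfl⟩⟩ rfl rfl
      refine ⟨DirectSum.of (fun F : 𝓣 => Additive (QuotDerived (F : Subgroup G))) ⟨_, hT⟩
        (Additive.ofMul (QuotientGroup.mk ⟨_, (mem_conjBy _ _ _).2 ⟨x, x.2, rfl⟩⟩)), ?_⟩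
      rw [DirectSum.toAddMonoid_of]
      change Additive.ofMul (Abelianization.of (toActiveSum _ _)) = _
      rw [← h]
      simp [mul_comm]
    | mul x y hx hy =>
      obtain ⟨v, hv⟩ := hx
      obtain ⟨w, hw⟩ := hy
      exact ⟨v + w, by rw [map_add, hv, hw, map_mul, ofMul_mul]⟩
  -- Since the composite is injective and τ is surjective, the map of abelianizations is injective.
  have hcomp : (MonoidHom.toAdditive (Abelianization.map (activeSumToGroup 𝓕))).comp τ =
      directSumMap 𝓣 := by
    refine DirectSum.addHom_ext fun F y => ?_
    simp only [AddMonoidHom.comp_apply, τ, directSumMap, DirectSum.toAddMonoid_of]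
    induction y using Additive.rec with
    | ofMul y =>
    induction y using QuotientGroup.induction_on with
    | H x =>
      change Additive.ofMul (Abelianization.of (activeSumToGroup 𝓕
        (toActiveSum ⟨F, hsub F.2⟩ x))) = _
      rw [activeSumToGroup_toActiveSum]
      rfl
  intro s hs
  obtain ⟨w, hw⟩ := hτ s
  have hw0 : directSumMap 𝓣 w = 0 := by
    rw [← hcomp, AddMonoidHom.comp_apply, hw]
    change Additive.ofMul (Abelianization.of (activeSumToGroup 𝓕 s)) = 0
    rw [MonoidHom.mem_ker.1 hs, map_one, ofMul_one]
  rw [hinj (hw0.trans (map_zero _).symm), map_zero] at hw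
  exact (QuotientGroup.eq_one_iff s).1 hw.symm

end SubgroupFamily

/-! ### Central extensions of metacyclic groups -/

/-- If `N` is a normal subgroup with commuting elements and `S = N ⟨b⟩`, then the derived
subgroup of `S` consists of commutators `k⁻¹ (b⁻¹ k b)` with `k` in `N`. -/
theorem exists_eq_inv_mul_conj_of_mem_commutator {S : Type*} [Group S] (N : Subgroup S)
    [N.Normal] (hN : ∀ x ∈ N, ∀ y ∈ N, x * y = y * x) (b : S)
    (hb : ∀ s : S, ∃ n : ℤ, ∃ k ∈ N, s = b ^ n * k)
    {z : S} (hz : z ∈ commutator S) : ∃ k ∈ N, z = k⁻¹ * (b⁻¹ * k * b) := by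
  have hc : ∀ k ∈ N, b⁻¹ * k * b ∈ N := fun k hk => by
    simpa using (inferInstance : N.Normal).conj_mem k hk b⁻¹
  have hc' : ∀ k ∈ N, b * k * b⁻¹ ∈ N := fun k hk => (inferInstance : N.Normal).conj_mem k hk b
  -- M is the image of k ↦ k⁻¹ (b⁻¹ k b), an endomorphism of N because N is abelian.
  let M : Subgroup S :=
    { carrier := {z | ∃ k ∈ N, z = k⁻¹ * (b⁻¹ * k * b)}
      one_mem' := ⟨1, one_mem _, by group⟩
      mul_mem' := by
        rintro _ _ ⟨k, hk, rfl⟩ ⟨l, hl, rfl⟩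
        refine ⟨k * l, mul_mem hk hl, ?_⟩
        have h := hN _ (hc k hk) _ (inv_mem hl)
        calc k⁻¹ * (b⁻¹ * k * b) * (l⁻¹ * (b⁻¹ * l * b))
            = k⁻¹ * ((b⁻¹ * k * b) * l⁻¹) * (b⁻¹ * l * b) := by group
          _ = (k⁻¹ * l⁻¹) * (b⁻¹ * (k * l) * b) := by rw [h]; group
          _ = _ := by rw [hN _ (inv_mem hk) _ (inv_mem hl), ← mul_inv_rev]
      inv_mem' := by
        rintro _ ⟨k, hk, rfl⟩
        refine ⟨k⁻¹, inv_mem hk, ?_⟩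
        rw [hN _ (inv_mem (inv_mem hk)) _ (hc _ (inv_mem hk))]
        group }
  have hMN : ∀ z ∈ M, z ∈ N := by
    rintro _ ⟨k, hk, rfl⟩
    exact mul_mem (inv_mem hk) (hc k hk)
  have hMb : ∀ z ∈ M, b * z * b⁻¹ ∈ M := by
    rintro _ ⟨k, hk, rfl⟩
    exact ⟨b * k * b⁻¹, hc' k hk, by group⟩
  have hMb' : ∀ z ∈ M, b⁻¹ * z * b ∈ M := by
    rintro _ ⟨k, hk, rfl⟩
    exact ⟨b⁻¹ * k * b, hc k hk, by group⟩
  have hnorm : Subgroup.normalizer (M : Set S) = ⊤ := by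
    have hbn : b ∈ Subgroup.normalizer (M : Set S) := by
      refine Subgroup.mem_normalizer_iff.2 fun z => ⟨hMb z, fun h => ?_⟩
      have := hMb' _ h
      rwa [show b⁻¹ * (b * z * b⁻¹) * b = z by group] at this
    have hNn : ∀ k ∈ N, k ∈ Subgroup.normalizer (M : Set S) := by
      intro k hk
      refine Subgroup.mem_normalizer_iff.2 fun z => ⟨fun h => ?_, fun h => ?_⟩
      · rwa [hN k hk z (hMN z h), mul_inv_cancel_right]
      · have := hN k hk _ (hMN _ h)
        rw [inv_mul_cancel_right] at this
        rwa [← mul_left_cancel this]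
    refine eq_top_iff.2 fun s _ => ?_
    obtain ⟨n, k, hk, rfl⟩ := hb s
    exact mul_mem (zpow_mem hbn n) (hNn k hk)
  have : M.Normal := Subgroup.normalizer_eq_top_iff.1 hnorm
  -- Modulo M the element b commutes with N, so S ⧸ M is abelian.
  have hcomm : ∀ k ∈ N, Commute (b : S ⧸ M) (k : S ⧸ M) := by
    intro k hk
    change ((b * k : S) : S ⧸ M) = ((k * b : S) : S ⧸ M)
    refine QuotientGroup.eq.2 ?_
    have h2 : k⁻¹ * (b⁻¹ * k * b) ∈ M := ⟨k, hk, rfl⟩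
    rwa [show (b * k)⁻¹ * (k * b) = k⁻¹ * (b⁻¹ * k * b) by group]
  have hle : commutator S ≤ M := by
    rw [commutator_def, Subgroup.commutator_le]
    intro x _ y _
    obtain ⟨n, k, hk, rfl⟩ := hb x
    obtain ⟨m, l, hl, rfl⟩ := hb y
    rw [← QuotientGroup.eq_one_iff, ← QuotientGroup.mk'_apply, map_commutatorElement,
      commutatorElement_eq_one_iff_commute]
    simp only [QuotientGroup.mk'_apply, QuotientGroup.mk_mul, QuotientGroup.mk_zpow]
    have hkl : Commute (k : S ⧸ M) (l : S ⧸ M) :=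
      congrArg ((↑) : S → S ⧸ M) (hN k hk l hl)
    exact (((Commute.refl _).zpow_zpow n m).mul_right ((hcomm l hl).zpow_left n)).mul_left
      (((hcomm k hk).symm.zpow_right m).mul_right hkl)
  exact hle hz

/-- A central extension of a metacyclic group whose kernel lies in the derived subgroup, and in
which all elements lying over the centre are central, is trivial. -/
theorem IsMetacyclic.injective_of_ker_le_commutator {S G : Type*} [Group S] [Group G]
    (hG : IsMetacyclic G) (φ : S →* G) (hφ : Function.Surjective φ)
    (hker : φ.ker ≤ commutator S)
    (hcen : ∀ t : S, φ t ∈ Subgroup.center G → ∀ s, Commute s t) : Function.Injective φ := by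
  obtain ⟨K, hK, hKc, hGK⟩ := hG
  obtain ⟨⟨a, ha⟩, hagen⟩ := hKc.exists_generator
  obtain ⟨b', hbgen⟩ := hGK.exists_generator
  obtain ⟨b₀, rfl⟩ := QuotientGroup.mk_surjective b'
  obtain ⟨b, rfl⟩ := hφ b₀
  obtain ⟨α, rfl⟩ := hφ a
  have hdec : ∀ g : G, ∃ n : ℤ, ∃ k ∈ K, g = φ b ^ n * k := by
    intro g
    obtain ⟨n, hn⟩ := hbgen g
    exact ⟨n, (φ b ^ n)⁻¹ * g, QuotientGroup.eq.1 hn, by group⟩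
  have hab : ∀ x ∈ K, ∀ y ∈ K, x * y = y * x := fun x hx y hy =>
    letI := hKc.commGroup
    congrArg Subtype.val (mul_comm (⟨x, hx⟩ : K) ⟨y, hy⟩)
  have hpow : ∀ x ∈ K.comap φ, ∃ n : ℤ, ∃ c ∈ φ.ker, x = α ^ n * c := by
    intro x hx
    obtain ⟨n, hn⟩ := hagen ⟨φ x, hx⟩
    have hn' : φ α ^ n = φ x := congrArg Subtype.val hn
    exact ⟨n, (α ^ n)⁻¹ * x, by simp [MonoidHom.mem_ker, hn'], by group⟩
  have hkc : ∀ c ∈ φ.ker, ∀ s, Commute s c := fun c hc =>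
    hcen c (by rw [MonoidHom.mem_ker.1 hc]; exact one_mem _)
  have habS : ∀ x ∈ K.comap φ, ∀ y ∈ K.comap φ, x * y = y * x := by
    intro x hx y hy
    obtain ⟨n, c, hc, rfl⟩ := hpow x hx
    obtain ⟨m, d, hd, rfl⟩ := hpow y hy
    exact (((Commute.refl α).zpow_zpow n m).mul_right (hkc d hd _)).mul_left (hkc c hc _).symm
  have hdecS : ∀ s : S, ∃ n : ℤ, ∃ k ∈ K.comap φ, s = b ^ n * k := by
    intro s
    obtain ⟨n, k, hk, h⟩ := hdec (φ s)
    exact ⟨n, (b ^ n)⁻¹ * s, by simpa [Subgroup.mem_comap, h] using hk, by group⟩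
  rw [injective_iff_map_eq_one]
  intro z hz
  obtain ⟨t, ht, rfl⟩ := exists_eq_inv_mul_conj_of_mem_commutator (K.comap φ) habS b hdecS
    (hker hz)
  -- The kernel element is [t, b] up to convention; its image being trivial says that φ t commutes
  -- with φ b.
  have hbt : Commute (φ b) (φ t) := by
    have h : (φ t)⁻¹ * ((φ b)⁻¹ * φ t * φ b) = 1 := by simpa using hz
    rw [inv_mul_eq_one, mul_assoc, eq_inv_mul_iff_mul_eq] at h
    exact h
  have hcenter : φ t ∈ Subgroup.center G := by
    refine Subgroup.mem_center_iff.2 fun g => ?_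
    obtain ⟨n, k, hk, rfl⟩ := hdec g
    exact (hbt.zpow_left n).mul_left (hab k hk _ ht)
  have h := hcen t hcenter b
  rw [mul_assoc, ← h.eq]
  group

theorem mainTheorem5 {G : Type*} [Group G] [Finite G] (hG : IsMetacyclic G)
    (𝓕 : Set (Subgroup G)) (hconj : SubgroupFamily.IsConjClosed 𝓕)
    (hgen : SubgroupFamily.IsGenerating 𝓕) (hreg : SubgroupFamily.IsRegular 𝓕)
    (hind : SubgroupFamily.IsIndependent 𝓕) :
    ∃ e : SubgroupFamily.ActiveSum 𝓕 ≃* G,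
      e.toMonoidHom = SubgroupFamily.activeSumToGroup 𝓕 := by
  have hsurj := SubgroupFamily.activeSumToGroup_surjective hgen
  have hinj := hG.injective_of_ker_le_commutator (SubgroupFamily.activeSumToGroup 𝓕) hsurj
    (SubgroupFamily.ker_activeSumToGroup_le_commutator hconj hgen hreg hind)
    fun _ ht => SubgroupFamily.commute_of_activeSumToGroup_mem_center hconj ht
  exact ⟨MulEquiv.ofBijective _ ⟨hinj, hsurj⟩, rfl⟩
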